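/- Let $k$ be a field, $Q$ a finite quiver and $kQ$ its path algebra, where paths are composed from left to right, so that an arrow $a\colon x\to y$ satisfies $a=e_x a e_y$ with $e_x$ the trivial path at $x$. Let $I\subseteq kQ$ be an admissible ideal, that is, a two-sided ideal with $J^N\subseteq I\subseteq J^2$ for some $N\ge 2$, where $J$ is the ideal generated by the arrows, and put $\Lambda=kQ/I$. Let $a_1,\dots,a_t$ be pairwise distinct arrows of $Q$, and let $e_i$ and $f_i$ be the trivial paths at the source and at the target of $a_i$. Suppose that there is a minimal generating set of $I$ (a set generating the two-sided ideal $I$, no proper subset of which generates $I$) such that no $a_i$ occurs in any path having a non-zero coefficient in an element of this set, and that $\operatorname{Hom}_\Lambda(e_i\Lambda,f_j\Lambda)=0$ (homomorphisms of right $\Lambda$-modules) for all $i,j\in\{1,\dots,t\}$. Write $\bar x$ for the class of $x\in kQ$ in $\Lambda$, let $\Gamma=\Lambda/\Lambda\{\bar a_1,\dots,\bar a_t\}\Lambda$ with projection $\pi\colon\Lambda\to\Gamma$, and write $e_i,f_i$ also for the classes in $\Lambda$ and in $\Gamma$. Then the following hold. (i) $f_j\Gamma e_i\cong\operatorname{Hom}_\Gamma(e_i\Gamma,f_j\Gamma)=0$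 for all $i,j\in\{1,\dots,t\}$. (ii) There is a homomorphism of $k$-algebras $\nu\colon\Gamma\to\Lambda$ with $\pi\nu=\operatorname{id}_\Gamma$ and with $\nu(\pi(\bar p))=\bar p$ for every trivial path $p$ and every arrow $p\notin\{a_1,\dots,a_t\}$. Regard ideals of $\Lambda$ as $\Gamma$-$\Gamma$-bimodules along $\nu$. Then the sum $\sum_{i=1}^t\Lambda\bar a_i\Lambda$ is direct, that is, the summation map $\bigoplus_{i=1}^t\Lambda\bar a_i\Lambda\to\sum_{i=1}^t\Lambda\bar a_i\Lambda$ is an isomorphism of $\Gamma$-$\Gamma$-bimodules, and $$\Lambda\bar a_i\Lambda\cong\Gamma e_i\otimes_k f_i\Gamma$$ as $\Gamma$-$\Gamma$-bimodules for every $i$. In particular, $\sum_{i=1}^t\Lambda\bar a_i\Lambda$ is a projective $\Gamma$-$\Gamma$-bimodule, that is, a projective module over the enveloping algebra of $\Gamma$. (iii) $\Lambda$ is isomorphic, as a $k$-algebra, to the trivial extension $\Gamma\ltimes P$, where $P=\bigoplus_{i=1}^t\Gamma e_i\otimes_k f_i\Gamma$ (and $\operatorname{Hom}_\Gamma(e_i\Gamma,f_j\Gamma)=0$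 for all $i,j$ by (i)). -/

import Mathlib

open scoped TensorProduct DirectSum

namespace QuiverAlg

noncomputable section

universe u v w

/-! ### Path algebras

Paths are composed from left to right: for `p : a ⟶ b` and `q : b ⟶ c` the product `p * q` in the
path algebra is the path "first `p`, then `q`" from `a` to `c`.  So an arrow `a` from `x` to `y`
satisfies `a = e_x * a * e_y`. -/

/-- All paths of a quiver, with arbitrary source and target. -/
abbrev AnyPath (V : Type u) [Quiver.{v} V] := Σ x : V, Σ y : V, Quiver.Path x y

/-- The underlying vector space of the path algebra `kQ`: it has the paths of `Q` as a basis. -/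
def PathAlgebra (k : Type w) [Field k] (V : Type u) [Quiver.{v} V] :=
  AnyPath V →₀ k

namespace PathAlgebra

variable (k : Type w) [Field k] {V : Type u} [Quiver.{v} V]

instance : AddCommGroup (PathAlgebra k V) := inferInstanceAs (AddCommGroup (AnyPath V →₀ k))

instance : Module k (PathAlgebra k V) := inferInstanceAs (Module k (AnyPath V →₀ k))

/-- The basis element of `kQ` given by a path. -/
def ofPath {x y : V} (p : Quiver.Path x y) : PathAlgebra k V :=
  Finsupp.single (⟨x, y, p⟩ : AnyPath V) (1 : k)

/-- The trivial path `e_x` at the vertex `x`. -/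
def vertex (x : V) : PathAlgebra k V := ofPath k (Quiver.Path.nil : Quiver.Path x x)

/-- An arrow, as an element of the path algebra. -/
def arrow {x y : V} (a : x ⟶ y) : PathAlgebra k V := ofPath k a.toPath

variable {k}

/-- The paths that appear with a non-zero coefficient in an element of the path algebra. -/
def support (f : PathAlgebra k V) : Finset (AnyPath V) := Finsupp.support f

variable (k)

open Classical in
/-- The product of two paths: their concatenation if the first one ends where the second one
starts, and zero otherwise. -/
def pathMul (p q : AnyPath V) : PathAlgebra k V :=
  if h : q.1 = p.2.1 then ofPath k (p.2.2.comp (q.2.2.cast h rfl)) else 0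

/-- The bilinear extension of the product of paths. -/
def mulLin : PathAlgebra k V →ₗ[k] PathAlgebra k V →ₗ[k] PathAlgebra k V :=
  Finsupp.linearCombination k fun p : AnyPath V =>
    (Finsupp.linearCombination k fun q : AnyPath V => pathMul k p q :
      PathAlgebra k V →ₗ[k] PathAlgebra k V)

instance : Mul (PathAlgebra k V) := ⟨fun f g => mulLin k f g⟩

instance [Fintype V] : One (PathAlgebra k V) := ⟨∑ x : V, vertex k x⟩

theorem mul_eq (f g : PathAlgebra k V) : f * g = mulLin k f g := rfl

theorem one_eq [Fintype V] : (1 : PathAlgebra k V) = ∑ x : V, vertex k x := rfl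

theorem mulLin_ofPath {x y x' y' : V} (p : Quiver.Path x y) (q : Quiver.Path x' y') :
    mulLin k (ofPath k p) (ofPath k q) = pathMul k ⟨x, y, p⟩ ⟨x', y', q⟩ := by
  unfold mulLin ofPath
  erw [Finsupp.linearCombination_single, one_smul, Finsupp.linearCombination_single, one_smul]

theorem ofPath_mul_ofPath {x y z : V} (p : Quiver.Path x y) (q : Quiver.Path y z) :
    ofPath k p * ofPath k q = ofPath k (p.comp q) := by
  rw [mul_eq, mulLin_ofPath]
  simp [pathMul]

theorem ofPath_mul_ofPath_of_ne {x y x' y' : V} (p : Quiver.Path x y) (q : Quiver.Path x' y')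
    (h : x' ≠ y) : ofPath k p * ofPath k q = 0 := by
  rw [mul_eq, mulLin_ofPath]
  simp [pathMul, h]

variable {k} in
theorem induction_ofPath {P : PathAlgebra k V → Prop} (f : PathAlgebra k V) (h0 : P 0)
    (hadd : ∀ f g, P f → P g → P (f + g))
    (hs : ∀ (c : k) (x y : V) (p : Quiver.Path x y), P (c • ofPath k p)) : P f := by
  refine Finsupp.induction_linear (motive := P) f h0 hadd ?_
  rintro ⟨x, y, p⟩ c
  have h := hs c x y p
  unfold ofPath at h
  erw [Finsupp.smul_single, smul_eq_mul, mul_one] at h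
  exact h

theorem add_mul' (f g h : PathAlgebra k V) : (f + g) * h = f * h + g * h := by
  simp [mul_eq]

theorem mul_add' (f g h : PathAlgebra k V) : f * (g + h) = f * g + f * h := by
  simp [mul_eq]

theorem smul_mul' (c : k) (f g : PathAlgebra k V) : (c • f) * g = c • (f * g) := by
  simp [mul_eq]

theorem mul_smul' (c : k) (f g : PathAlgebra k V) : f * (c • g) = c • (f * g) := by
  simp [mul_eq]

theorem zero_mul' (f : PathAlgebra k V) : 0 * f = 0 := by
  simp [mul_eq]

theorem mul_zero' (f : PathAlgebra k V) : f * 0 = 0 := by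
  simp [mul_eq]

theorem mul_assoc' (f g h : PathAlgebra k V) : f * g * h = f * (g * h) := by
  induction f using induction_ofPath with
  | h0 => simp only [zero_mul']
  | hadd f₁ f₂ h₁ h₂ => simp only [add_mul', h₁, h₂]
  | hs c x y p =>
    induction g using induction_ofPath with
    | h0 => simp only [zero_mul', mul_zero']
    | hadd f₁ f₂ h₁ h₂ => simp only [add_mul', mul_add', h₁, h₂]
    | hs d x' y' q =>
      induction h using induction_ofPath with
      | h0 => simp only [mul_zero']
      | hadd f₁ f₂ h₁ h₂ => simp only [mul_add', h₁, h₂]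
      | hs b x'' y'' r =>
        simp only [smul_mul', mul_smul']
        congr 3
        by_cases h₁ : x' = y
        · subst h₁
          by_cases h₂ : x'' = y'
          · subst h₂
            simp only [ofPath_mul_ofPath, Quiver.Path.comp_assoc]
          · rw [ofPath_mul_ofPath_of_ne k q r h₂, ofPath_mul_ofPath,
              ofPath_mul_ofPath_of_ne k _ r h₂, mul_zero']
        · rw [ofPath_mul_ofPath_of_ne k p q h₁, zero_mul']
          by_cases h₂ : x'' = y'
          · subst h₂
            rw [ofPath_mul_ofPath, ofPath_mul_ofPath_of_ne k p _ h₁]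
          · rw [ofPath_mul_ofPath_of_ne k q r h₂, mul_zero']

theorem one_mul' [Fintype V] (f : PathAlgebra k V) : 1 * f = f := by
  classical
  induction f using induction_ofPath with
  | h0 => rw [mul_zero']
  | hadd f₁ f₂ h₁ h₂ => rw [mul_add', h₁, h₂]
  | hs c x y p =>
    rw [mul_smul', one_eq, mul_eq, map_sum, LinearMap.sum_apply]
    congr 1
    rw [Finset.sum_eq_single x]
    · exact (ofPath_mul_ofPath k _ _).trans (by rw [Quiver.Path.nil_comp])
    · intro b _ hb
      exact ofPath_mul_ofPath_of_ne k _ _ hb.symm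
    · simp

theorem mul_one' [Fintype V] (f : PathAlgebra k V) : f * 1 = f := by
  classical
  induction f using induction_ofPath with
  | h0 => rw [zero_mul']
  | hadd f₁ f₂ h₁ h₂ => rw [add_mul', h₁, h₂]
  | hs c x y p =>
    rw [smul_mul', one_eq, mul_eq, map_sum]
    congr 1
    rw [Finset.sum_eq_single y]
    · exact (ofPath_mul_ofPath k _ _).trans (by rw [Quiver.Path.comp_nil])
    · intro b _ hb
      exact ofPath_mul_ofPath_of_ne k _ _ hb
    · simp

instance [Fintype V] : Ring (PathAlgebra k V) where
  left_distrib := mul_add' k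
  right_distrib := add_mul' k
  zero_mul := zero_mul' k
  mul_zero := mul_zero' k
  mul_assoc := mul_assoc' k
  one_mul := one_mul' k
  mul_one := mul_one' k
  __ := (inferInstance : AddCommGroup (PathAlgebra k V))

instance [Fintype V] : Algebra k (PathAlgebra k V) :=
  Algebra.ofModule (smul_mul' k) (fun c f g => mul_smul' k c f g)

end PathAlgebra

/-! ### Admissible ideals, minimal generating sets, occurrence of arrows -/

/-- The arrow `a` occurs in some path that has a non-zero coefficient in `f`. -/
def Occurs {k : Type w} [Field k] {V : Type u} [Quiver.{v} V] {x y : V} (a : x ⟶ y) (f : PathAlgebra k V) : Prop :=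
  ∃ p ∈ f.support, ∃ (p₁ : Quiver.Path p.1 x) (p₂ : Quiver.Path y p.2.1),
    p.2.2 = (p₁.cons a).comp p₂

section Ideals

variable {k : Type w} [Field k] {V : Type u} [Quiver.{v} V] [Fintype V]

variable (k V) in
/-- The two-sided ideal of `kQ` generated by all arrows. -/
def arrowIdeal : TwoSidedIdeal (PathAlgebra k V) :=
  TwoSidedIdeal.span {f | ∃ (x y : V) (a : x ⟶ y), f = PathAlgebra.arrow k a}

/-- An ideal `I` of `kQ` is admissible if `J ^ N ⊆ I ⊆ J ^ 2` for some `N ≥ 2`, where `J` is the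
arrow ideal. -/
def IsAdmissible (I : TwoSidedIdeal (PathAlgebra k V)) : Prop :=
  (∃ N : ℕ, 2 ≤ N ∧ (arrowIdeal k V).asIdeal ^ N ≤ I.asIdeal) ∧
    I.asIdeal ≤ (arrowIdeal k V).asIdeal ^ 2

/-- `S` generates the two-sided ideal `I`, and no proper subset of `S` does. -/
def IsMinimalGeneratingSet (I : TwoSidedIdeal (PathAlgebra k V))
    (S : Set (PathAlgebra k V)) : Prop :=
  TwoSidedIdeal.span S = I ∧ ∀ T : Set (PathAlgebra k V), T ⊂ S → TwoSidedIdeal.span T ≠ I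

/-! ### The algebra `Λ = kQ/I` and its arrow removal -/

/-- The algebra `Λ = kQ/I`. -/
def BoundAlgebra (I : TwoSidedIdeal (PathAlgebra k V)) := PathAlgebra k V ⧸ I.asIdeal

instance (I : TwoSidedIdeal (PathAlgebra k V)) : Ring (BoundAlgebra I) :=
  inferInstanceAs (Ring (PathAlgebra k V ⧸ I.asIdeal))

instance (I : TwoSidedIdeal (PathAlgebra k V)) : Algebra k (BoundAlgebra I) :=
  inferInstanceAs (Algebra k (PathAlgebra k V ⧸ I.asIdeal))

/-- The canonical projection `kQ → Λ`. -/
def boundMk (I : TwoSidedIdeal (PathAlgebra k V)) : PathAlgebra k V →ₐ[k] BoundAlgebra I :=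
  Ideal.Quotient.mkₐ k I.asIdeal

/-- The class in `kQ/I` of the trivial path at `x`. -/
def vertexClass (I : TwoSidedIdeal (PathAlgebra k V)) (x : V) : BoundAlgebra I :=
  boundMk I (PathAlgebra.vertex k x)

/-- The class in `kQ/I` of an arrow. -/
def arrowClass (I : TwoSidedIdeal (PathAlgebra k V)) {x y : V} (a : x ⟶ y) : BoundAlgebra I :=
  boundMk I (PathAlgebra.arrow k a)

variable {t : ℕ} {s e : Fin t → V}

/-- The two-sided ideal `Λ{ā_1, …, ā_t}Λ` of `Λ = kQ/I`. -/
def removedIdeal (I : TwoSidedIdeal (PathAlgebra k V)) (a : ∀ i, s i ⟶ e i) :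
    TwoSidedIdeal (BoundAlgebra I) :=
  TwoSidedIdeal.span (Set.range fun i => arrowClass I (a i))

/-- The algebra `Γ = Λ / Λ{ā_1, …, ā_t}Λ`. -/
def Removal (I : TwoSidedIdeal (PathAlgebra k V)) (a : ∀ i, s i ⟶ e i) :=
  BoundAlgebra I ⧸ (removedIdeal I a).asIdeal

instance (I : TwoSidedIdeal (PathAlgebra k V)) (a : ∀ i, s i ⟶ e i) : Ring (Removal I a) :=
  inferInstanceAs (Ring (BoundAlgebra I ⧸ (removedIdeal I a).asIdeal))

instance (I : TwoSidedIdeal (PathAlgebra k V)) (a : ∀ i, s i ⟶ e i) : Algebra k (Removal I a) :=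
  inferInstanceAs (Algebra k (BoundAlgebra I ⧸ (removedIdeal I a).asIdeal))

/-- The canonical projection `π : Λ → Γ`. -/
def proj (I : TwoSidedIdeal (PathAlgebra k V)) (a : ∀ i, s i ⟶ e i) :
    BoundAlgebra I →ₐ[k] Removal I a :=
  Ideal.Quotient.mkₐ k (removedIdeal I a).asIdeal

/-- The class in `Γ` of the trivial path at `x`. -/
def removalVertex (I : TwoSidedIdeal (PathAlgebra k V)) (a : ∀ i, s i ⟶ e i) (x : V) :
    Removal I a :=
  proj I a (vertexClass I x)

end Ideals

/-! ### One-sided ideals and bimodules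

Left modules over `A` are `A`-modules, right modules over `A` are `Aᵐᵒᵖ`-modules, and `A`-bimodules
(with `k` acting centrally) are modules over the enveloping algebra `A ⊗[k] Aᵐᵒᵖ`. -/

section Bimodules

variable (k : Type w) [Field k] {A : Type u} [Ring A] [Algebra k A]

/-- The left ideal `A x`. -/
abbrev leftIdeal (x : A) : Submodule A A := Submodule.span A {x}

/-- The right ideal `x A`, a right module over `A`. -/
abbrev rightIdeal (x : A) : Submodule Aᵐᵒᵖ A := Submodule.span Aᵐᵒᵖ {x}

/-- `Hom_A(x A, y A)`: the homomorphisms of right `A`-modules from `x A` to `y A`. -/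
abbrev HomRight (x y : A) := rightIdeal x →ₗ[Aᵐᵒᵖ] rightIdeal y

instance (x y : A) : Module k (HomRight x y) := LinearMap.module

/-- The subspace `x A y` of `A`. -/
def corner (x y : A) : Submodule k A := LinearMap.range (LinearMap.mulLeftRight k (x, y))

variable (A) in
/-- The enveloping algebra, whose modules are the `A`-bimodules. -/
abbrev Env := A ⊗[k] Aᵐᵒᵖ

/-- The `A`-bimodule `A x ⊗_k y A`, where `A` acts from the left on the first and from the right
on the second factor. -/
def OuterTensor (x y : A) := leftIdeal x ⊗[k] rightIdeal y

namespace OuterTensor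

variable (x y : A)

instance : AddCommGroup (OuterTensor k x y) :=
  inferInstanceAs (AddCommGroup (leftIdeal x ⊗[k] rightIdeal y))

instance : Module k (OuterTensor k x y) :=
  inferInstanceAs (Module k (leftIdeal x ⊗[k] rightIdeal y))

/-- The left action: `c • (p ⊗ q) = (c * p) ⊗ q`. -/
instance : Module A (OuterTensor k x y) :=
  inferInstanceAs (Module A (leftIdeal x ⊗[k] rightIdeal y))

/-- The right action as a homomorphism of algebras: it sends `c` to the map
`p ⊗ q ↦ p ⊗ (q * c)`. -/
def rightHom : Aᵐᵒᵖ →ₐ[k] Module.End k (leftIdeal x ⊗[k] rightIdeal y) :=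
  (Module.End.lTensorAlgHom k (rightIdeal y) (leftIdeal x)).comp
    (Algebra.lsmul k k (rightIdeal y))

/-- The right action: `(p ⊗ q) • c = p ⊗ (q * c)`. -/
instance : Module Aᵐᵒᵖ (OuterTensor k x y) :=
  Module.compHom (leftIdeal x ⊗[k] rightIdeal y) (rightHom k x y).toRingHom

/-- The element `p ⊗ q`. -/
def mk (p : leftIdeal x) (q : rightIdeal y) : OuterTensor k x y := p ⊗ₜ[k] q

theorem smul_mk (c : A) (p : leftIdeal x) (q : rightIdeal y) :
    c • mk k x y p q = mk k x y (c • p) q := rfl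

theorem op_smul_mk (c : Aᵐᵒᵖ) (p : leftIdeal x) (q : rightIdeal y) :
    c • mk k x y p q = mk k x y p (c • q) := rfl

theorem smul_eq_rTensor (c : A) (z : OuterTensor k x y) :
    c • z = LinearMap.rTensor (rightIdeal y) (Algebra.lsmul k k (leftIdeal x) c) z := rfl

theorem op_smul_eq_lTensor (c : Aᵐᵒᵖ) (z : OuterTensor k x y) :
    c • z = LinearMap.lTensor (leftIdeal x) (Algebra.lsmul k k (rightIdeal y) c) z := rfl

instance : IsScalarTower k A (OuterTensor k x y) :=
  inferInstanceAs (IsScalarTower k A (leftIdeal x ⊗[k] rightIdeal y))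

instance : IsScalarTower k Aᵐᵒᵖ (OuterTensor k x y) where
  smul_assoc c d z := LinearMap.congr_fun (map_smul (rightHom k x y) c d) z

instance : SMulCommClass A Aᵐᵒᵖ (OuterTensor k x y) where
  smul_comm c d z := by
    let F := Algebra.lsmul k k (leftIdeal x) c
    let G := Algebra.lsmul k k (rightIdeal y) d
    have h : LinearMap.rTensor (rightIdeal y) F ∘ₗ LinearMap.lTensor (leftIdeal x) G =
        LinearMap.lTensor (leftIdeal x) G ∘ₗ LinearMap.rTensor (rightIdeal y) F := by
      rw [LinearMap.rTensor_comp_lTensor, LinearMap.lTensor_comp_rTensor]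
    exact LinearMap.congr_fun h z

instance : Module (Env k A) (OuterTensor k x y) := TensorProduct.Algebra.module

end OuterTensor

/-- A two-sided ideal `J` of `B`, viewed as an `A`-bimodule along a homomorphism of algebras
`ν : A → B`. -/
def IdealAlong {k : Type w} [Field k] {A : Type u} [Ring A] [Algebra k A] {B : Type v} [Ring B]
    [Algebra k B] (_ν : A →ₐ[k] B) (J : TwoSidedIdeal B) : Type v := J

namespace IdealAlong

variable {k}
variable {B : Type v} [Ring B] [Algebra k B] (ν : A →ₐ[k] B) (J : TwoSidedIdeal B)

instance : AddCommGroup (IdealAlong ν J) := inferInstanceAs (AddCommGroup J)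

instance : Module k (IdealAlong ν J) := Module.compHom J (algebraMap k B)

/-- The left action: `c • z = ν c * z`. -/
instance : Module A (IdealAlong ν J) := Module.compHom J ν.toRingHom

/-- The right action: `z • c = z * ν c`. -/
instance : Module Aᵐᵒᵖ (IdealAlong ν J) := Module.compHom J ν.toRingHom.op

variable {ν J}

/-- The underlying element of `B`. -/
def val (z : IdealAlong ν J) : B := Subtype.val (p := fun b => b ∈ J) z

theorem val_injective : Function.Injective (val : IdealAlong ν J → B) := Subtype.val_injective

theorem val_smul (c : A) (z : IdealAlong ν J) : (c • z).val = ν c * z.val := rfl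

theorem val_op_smul (c : Aᵐᵒᵖ) (z : IdealAlong ν J) : (c • z).val = z.val * ν c.unop := rfl

theorem val_base_smul (c : k) (z : IdealAlong ν J) : (c • z).val = c • z.val :=
  (Algebra.smul_def c z.val).symm

instance : IsScalarTower k A (IdealAlong ν J) where
  smul_assoc c d z := val_injective (by
    rw [val_smul, val_base_smul, val_smul, map_smul, smul_mul_assoc])

instance : IsScalarTower k Aᵐᵒᵖ (IdealAlong ν J) where
  smul_assoc c d z := val_injective (by
    rw [val_op_smul, val_base_smul, val_op_smul, MulOpposite.unop_smul, map_smul, mul_smul_comm])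

instance : SMulCommClass A Aᵐᵒᵖ (IdealAlong ν J) where
  smul_comm c d z := val_injective (by
    rw [val_smul, val_op_smul, val_op_smul, val_smul, mul_assoc])

instance : Module (Env k A) (IdealAlong ν J) := TensorProduct.Algebra.module

end IdealAlong

end Bimodules

end

end QuiverAlg

/-! No removed arrow $a_i$ occurs in the chosen generators of $I$. A homomorphism out of $kQ$ that
agrees with some composite $kQ\to\Lambda\to B$ on the vertices and on the other arrows therefore
kills these generators, hence $I$, whatever it does to the $a_i$
(`map_eq_zero_of_generatedAvoiding`). So the images of the $a_i$ may be chosen freely, up to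
compatibility with their endpoints.

Two choices give everything. Sending each $a_i$ to $0$ yields $\Lambda\to\Lambda$, which factors
through $\Gamma$ and is the section $\nu$ (`removalSection`). Sending $a_i$ to $e_i\otimes f_i$
yields $\Lambda\to\Gamma\ltimes P$ (`toExt`).

For the way back, $p\otimes q\mapsto\nu(p)\bar a_i\nu(q)$ maps $P$ to $\Lambda$. The Hom condition
says $f_j\Lambda e_i=0$, which passes to $f_j\Gamma e_i=0$. In a product $\nu(p)\bar
a_i\nu(q)\,\nu(p')\bar a_j\nu(q')$ the factor $qp'$ lies in $f_i\Gamma e_j=0$, so the image of $P$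
squares to zero and the map extends to $\Gamma\ltimes P\to\Lambda$ (`ofExt`). The two homomorphisms
are inverse to each other, as can be checked on generators (`extEquiv`).

The bimodule statements are read off from this isomorphism. The ideal $\Lambda\bar a_i\Lambda$ is
the image of the $i$-th summand of $P$ (`mem_span_iff_sandwich`), so these ideals are independent
because the summands are. Each summand is projective, being a direct summand of the enveloping
algebra. -/

namespace QuiverAlg

noncomputable section

universe u v w

/-! ### Universal property of the path algebra -/

namespace PathAlgebra

section Lift

variable {k : Type w} [Field k] {V : Type u} [Quiver.{v} V] {B : Type*} [Ring B] [Algebra k B]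

/-- The value of a path when vertices and arrows are given values in a ring. -/
def pathValue (v : V → B) (F : ∀ {x y : V}, (x ⟶ y) → B) {x : V} :
    ∀ {y : V}, Quiver.Path x y → B
  | _, .nil => v x
  | _, .cons p b => pathValue v F p * F b

variable {v : V → B} {F : ∀ {x y : V}, (x ⟶ y) → B}

theorem pathValue_mul_vertex (hid : ∀ x, v x * v x = v x)
    (hr : ∀ {x y : V} (b : x ⟶ y), F b * v y = F b) {x y : V} (p : Quiver.Path x y) :
    pathValue v F p * v y = pathValue v F p := by
  cases p with
  | nil => exact hid x
  | cons p b => simp only [pathValue, mul_assoc, hr]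

/-- The value of a path begins with the value of its source vertex, so idempotency is enough here
and no left compatibility of `F` is needed. For the same reason `lift` asks only for right
compatibility. -/
theorem vertex_mul_pathValue (hid : ∀ x, v x * v x = v x) {x y : V} (p : Quiver.Path x y) :
    v x * pathValue v F p = pathValue v F p := by
  induction p with
  | nil => exact hid x
  | cons p b ih => simp only [pathValue, ← mul_assoc, ih]

theorem pathValue_comp (hid : ∀ x, v x * v x = v x)
    (hr : ∀ {x y : V} (b : x ⟶ y), F b * v y = F b) {x y z : V}
    (p : Quiver.Path x y) (q : Quiver.Path y z) :
    pathValue v F (p.comp q) = pathValue v F p * pathValue v F q := by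
  induction q with
  | nil => exact (pathValue_mul_vertex hid hr p).symm
  | cons q b ih => simp only [Quiver.Path.comp_cons, pathValue, ih, mul_assoc]

theorem vertex_mul_self (x : V) : vertex k x * vertex k x = vertex k x :=
  ofPath_mul_ofPath k _ _

theorem vertex_mul_vertex_of_ne {x y : V} (h : x ≠ y) : vertex k x * vertex k y = 0 :=
  ofPath_mul_ofPath_of_ne k _ _ h.symm

theorem vertex_mul_arrow {x y : V} (b : x ⟶ y) : vertex k x * arrow k b = arrow k b :=
  ofPath_mul_ofPath k _ _

theorem arrow_mul_vertex {x y : V} (b : x ⟶ y) : arrow k b * vertex k y = arrow k b :=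
  ofPath_mul_ofPath k _ _

variable [Fintype V]

/-- The universal property of the path algebra: values of the vertices and of the arrows extend to
a homomorphism of algebras if the former are orthogonal idempotents with sum `1`, compatible with
the latter. -/
def lift (v : V → B) (F : ∀ {x y : V}, (x ⟶ y) → B) (hid : ∀ x, v x * v x = v x)
    (horth : ∀ x y, x ≠ y → v x * v y = 0) (hone : ∑ x, v x = 1)
    (hr : ∀ {x y : V} (b : x ⟶ y), F b * v y = F b) : PathAlgebra k V →ₐ[k] B :=
  let L : PathAlgebra k V →ₗ[k] B :=
    Finsupp.linearCombination k fun p : AnyPath V => pathValue v F p.2.2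
  have hL {x y : V} (p : Quiver.Path x y) : L (ofPath k p) = pathValue v F p :=
    (Finsupp.linearCombination_single k 1 (⟨x, y, p⟩ : AnyPath V)).trans (one_smul k _)
  AlgHom.ofLinearMap L
    (by
      rw [one_eq, map_sum, ← hone]
      exact Finset.sum_congr rfl fun x _ => hL _)
    (by
      intro f g
      induction f using induction_ofPath with
      | h0 => simp only [zero_mul, map_zero]
      | hadd f₁ f₂ h₁ h₂ => simp only [add_mul, map_add, h₁, h₂]
      | hs c x y p =>
        induction g using induction_ofPath with
        | h0 => simp only [mul_zero, map_zero]
        | hadd f₁ f₂ h₁ h₂ => simp only [mul_add, map_add, h₁, h₂]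
        | hs d x' y' q =>
          simp only [smul_mul_assoc, mul_smul_comm, map_smul, hL]
          congr 2
          by_cases h : x' = y
          · subst h
            rw [ofPath_mul_ofPath, hL, pathValue_comp hid hr]
          · rw [ofPath_mul_ofPath_of_ne k p q h, map_zero, ← pathValue_mul_vertex hid hr p,
              ← vertex_mul_pathValue hid q, mul_assoc, ← mul_assoc (v y),
              horth y x' (Ne.symm h), zero_mul, mul_zero])

section

variable (hid : ∀ x, v x * v x = v x) (horth : ∀ x y, x ≠ y → v x * v y = 0)
  (hone : ∑ x, v x = 1)
  (hr : ∀ {x y : V} (b : x ⟶ y), F b * v y = F b)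

theorem lift_ofPath {x y : V} (p : Quiver.Path x y) :
    lift (k := k) v F hid horth hone hr (ofPath k p) = pathValue v F p :=
  (Finsupp.linearCombination_single k 1 (⟨x, y, p⟩ : AnyPath V)).trans (one_smul k _)

theorem lift_vertex (x : V) : lift (k := k) v F hid horth hone hr (vertex k x) = v x :=
  lift_ofPath hid horth hone hr _

/-- The value of a path of length one is `v x * F b`; left compatibility is what reduces it to `F
b`. -/
theorem lift_arrow (hl : ∀ {x y : V} (b : x ⟶ y), v x * F b = F b) {x y : V} (b : x ⟶ y) :
    lift (k := k) v F hid horth hone hr (arrow k b) = F b :=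
  (lift_ofPath hid horth hone hr _).trans (hl b)

end

/-- Agreement is required only at arrows through which `p` factors. This lets the values at the
removed arrows differ when `p` avoids them. -/
theorem map_ofPath_congr {f g : PathAlgebra k V →ₐ[k] B}
    (hv : ∀ x, f (vertex k x) = g (vertex k x)) {x y : V} (p : Quiver.Path x y)
    (hp : ∀ {x' y' : V} (b : x' ⟶ y') (p₁ : Quiver.Path x x') (p₂ : Quiver.Path y' y),
      p = (p₁.cons b).comp p₂ → f (arrow k b) = g (arrow k b)) :
    f (ofPath k p) = g (ofPath k p) := by
  induction p with
  | nil => exact hv x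
  | cons p b ih =>
    have h : ofPath k (p.cons b) = ofPath k p * arrow k b := (ofPath_mul_ofPath k p b.toPath).symm
    rw [h, map_mul, map_mul, hp b p .nil rfl,
      ih fun c p₁ p₂ e => hp c p₁ (p₂.cons b) (by rw [e, Quiver.Path.comp_cons])]

/-- Homomorphisms that agree on the vertices and on the arrows occurring in `z` agree on `z`. -/
theorem map_congr_of_occurs {f g : PathAlgebra k V →ₐ[k] B}
    (hv : ∀ x, f (vertex k x) = g (vertex k x)) (z : PathAlgebra k V)
    (hz : ∀ {x y : V} (b : x ⟶ y), Occurs b z → f (arrow k b) = g (arrow k b)) : f z = g z := by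
  let c : AnyPath V →₀ k := z
  have hsum : z = ∑ p ∈ z.support, c p • ofPath k p.2.2 := by
    refine (Finsupp.sum_single c).symm.trans ?_
    refine Finset.sum_congr rfl fun p _ => ?_
    refine Eq.trans ?_ (Finsupp.smul_single _ _ _).symm
    rw [smul_eq_mul, mul_one]
  rw [hsum, map_sum, map_sum]
  refine Finset.sum_congr rfl fun p hp => ?_
  rw [map_smul, map_smul,
    map_ofPath_congr hv p.2.2 fun b p₁ p₂ e => hz b ⟨p, hp, p₁, p₂, e⟩]

theorem algHom_ext {f g : PathAlgebra k V →ₐ[k] B} (hv : ∀ x, f (vertex k x) = g (vertex k x))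
    (ha : ∀ {x y : V} (b : x ⟶ y), f (arrow k b) = g (arrow k b)) : f = g :=
  AlgHom.ext fun z => map_congr_of_occurs hv z fun b _ => ha b

end Lift

end PathAlgebra

/-! ### Corners, homomorphisms between principal right ideals, and bimodule maps -/

section BimoduleLemmas

variable (k : Type w) [Field k] {A : Type u} [Ring A] [Algebra k A]

theorem mem_corner {x y z : A} : z ∈ corner k x y ↔ ∃ c, x * c * y = z := Iff.rfl

theorem mem_leftIdeal {x z : A} : z ∈ leftIdeal x ↔ ∃ c, c * x = z := Submodule.mem_span_singleton

theorem mem_rightIdeal {x z : A} : z ∈ rightIdeal x ↔ ∃ c, x * c = z :=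
  Submodule.mem_span_singleton.trans
    ⟨fun ⟨c, h⟩ => ⟨c.unop, h⟩, fun ⟨c, h⟩ => ⟨MulOpposite.op c, h⟩⟩

theorem mul_eq_of_mem_leftIdeal {x z : A} (hx : x * x = x) (hz : z ∈ leftIdeal x) : z * x = z := by
  obtain ⟨c, rfl⟩ := mem_leftIdeal.1 hz
  rw [mul_assoc, hx]

theorem mul_eq_of_mem_rightIdeal {x z : A} (hx : x * x = x) (hz : z ∈ rightIdeal x) :
    x * z = z := by
  obtain ⟨c, rfl⟩ := mem_rightIdeal.1 hz
  rw [← mul_assoc, hx]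

/-- `y A x ≅ Hom_A(x A, y A)` for an idempotent `x`, by left multiplication. -/
def cornerEquivHomRight {x y : A} (hx : x * x = x) : corner k y x ≃ₗ[k] HomRight x y where
  toFun z :=
    { toFun := fun q => ⟨z * q, by
        obtain ⟨c, hc⟩ := (mem_corner k).1 z.2
        exact mem_rightIdeal.2 ⟨c * x * q, by rw [← hc]; simp only [mul_assoc]⟩⟩
      map_add' := fun q r => Subtype.ext (mul_add _ _ _)
      map_smul' := fun c q => Subtype.ext (mul_assoc z.1 q.1 c.unop).symm }
  map_add' z w := LinearMap.ext fun q => Subtype.ext (add_mul z.1 w.1 q.1)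
  map_smul' c z := LinearMap.ext fun q => Subtype.ext (smul_mul_assoc c z.1 q.1)
  invFun φ := ⟨φ ⟨x, Submodule.mem_span_singleton_self x⟩, by
    obtain ⟨c, hc⟩ := mem_rightIdeal.1 (φ ⟨x, Submodule.mem_span_singleton_self x⟩).2
    refine (mem_corner k).2 ⟨c, ?_⟩
    -- Since `x` is idempotent, `φ x = φ (x * x) = φ x * x`, so `φ x` lies in `y A x` and not merely
    -- in `y A`.
    have h := φ.map_smul (MulOpposite.op x) ⟨x, Submodule.mem_span_singleton_self x⟩
    have hxx : MulOpposite.op x • (⟨x, Submodule.mem_span_singleton_self x⟩ : rightIdeal x) =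
      ⟨x, Submodule.mem_span_singleton_self x⟩ := Subtype.ext hx
    rw [hxx] at h
    rw [hc]
    exact (congrArg Subtype.val h).symm⟩
  left_inv z := by
    obtain ⟨c, hc⟩ := (mem_corner k).1 z.2
    refine Subtype.ext ?_
    change z.1 * x = z.1
    rw [← hc, mul_assoc, hx]
  right_inv φ := LinearMap.ext fun q => by
    refine Subtype.ext ?_
    -- Every `q` in `x A` equals `x * q`, so `φ q = φ x * q`: the map is determined by its value at
    -- `x`.
    refine Eq.trans ?_ (congrArg (fun q => (φ q).1) (Subtype.ext (mul_eq_of_mem_rightIdeal hx q.2) :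
      MulOpposite.op q.1 • (⟨x, Submodule.mem_span_singleton_self x⟩ : rightIdeal x) = q))
    exact (congrArg Subtype.val (φ.map_smul (MulOpposite.op q.1) ⟨x, _⟩)).symm

variable {k}

/-- Left multiplication by `y * c * x` is a homomorphism from `x A` to `y A`, and it determines this
element. -/
theorem mul_mul_eq_zero_of_homRight (k : Type*) [Field k] {A : Type*} [Ring A] [Algebra k A]
    {x y : A} (hx : x * x = x) (h : ∀ φ : HomRight x y, φ = 0) (c : A) : y * c * x = 0 := by
  have hz := h (cornerEquivHomRight k hx ⟨y * c * x, (mem_corner k).2 ⟨c, rfl⟩⟩)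
  rw [LinearEquiv.map_eq_zero_iff] at hz
  exact congrArg Subtype.val hz

theorem corner_eq_bot {x y : A} (h : ∀ c, y * c * x = 0) : corner k y x = ⊥ :=
  (Submodule.eq_bot_iff _).2 fun z hz => by
    obtain ⟨c, rfl⟩ := (mem_corner k).1 hz
    exact h c

theorem homRight_eq_zero (k : Type*) [Field k] {A : Type*} [Ring A] [Algebra k A] {x y : A}
    (hx : x * x = x) (h : ∀ c, y * c * x = 0) (φ : HomRight x y) : φ = 0 := by
  rw [← (cornerEquivHomRight k hx).symm.map_eq_zero_iff]
  exact Subtype.ext ((Submodule.eq_bot_iff _).1 (corner_eq_bot (k := k) h) _ (Subtype.prop _))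

section EnvLinear

variable {M N : Type*} [AddCommGroup M] [Module k M] [Module A M] [Module Aᵐᵒᵖ M]
  [IsScalarTower k A M] [IsScalarTower k Aᵐᵒᵖ M] [SMulCommClass A Aᵐᵒᵖ M]
  [AddCommGroup N] [Module k N] [Module A N] [Module Aᵐᵒᵖ N]
  [IsScalarTower k A N] [IsScalarTower k Aᵐᵒᵖ N] [SMulCommClass A Aᵐᵒᵖ N]

/-- An additive map that commutes with both actions is linear over the enveloping algebra, for the
bimodule structures given by `TensorProduct.Algebra.module`. -/
theorem map_env_smul (f : M →+ N) (hl : ∀ (c : A) m, f (c • m) = c • f m)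
    (hr : ∀ (c : Aᵐᵒᵖ) m, f (c • m) = c • f m) (c : Env k A) (m : M) :
    letI : Module (Env k A) M := TensorProduct.Algebra.module
    letI : Module (Env k A) N := TensorProduct.Algebra.module
    f (c • m) = c • f m := by
  let : Module (Env k A) M := TensorProduct.Algebra.module
  let : Module (Env k A) N := TensorProduct.Algebra.module
  induction c using TensorProduct.induction_on with
  | zero =>
    exact (congrArg f (zero_smul (Env k A) m)).trans
      ((map_zero f).trans (zero_smul (Env k A) (f m)).symm)
  | tmul c d => rw [TensorProduct.Algebra.smul_def, TensorProduct.Algebra.smul_def, hl, hr]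
  | add c d hc hd =>
    exact (congrArg f (add_smul (R := Env k A) c d m)).trans ((map_add f _ _).trans
      ((congrArg₂ (· + ·) hc hd).trans (add_smul (R := Env k A) c d (f m)).symm))

end EnvLinear

/-! ### The bimodule `A x ⊗ y A`: projectivity and maps into an algebra -/

namespace OuterTensor

variable {x y : A}

theorem induction {P : OuterTensor k x y → Prop} (z : OuterTensor k x y) (h0 : P 0)
    (hmk : ∀ p q, P (mk k x y p q)) (hadd : ∀ z w, P z → P w → P (z + w)) : P z :=
  TensorProduct.induction_on z h0 hmk hadd

theorem env_smul_mk (c : A) (d : Aᵐᵒᵖ) (p : leftIdeal x) (q : rightIdeal y) :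
    (c ⊗ₜ[k] d : Env k A) • mk k x y p q = mk k x y (c • p) (d • q) :=
  TensorProduct.Algebra.smul_def c d _

variable (k x y) in
/-- The element `x ⊗ y`. -/
def gen : OuterTensor k x y :=
  mk k x y ⟨x, Submodule.mem_span_singleton_self x⟩ ⟨y, Submodule.mem_span_singleton_self y⟩

/-- Idempotency makes `x ⊗ y` a generator of the bimodule. This gives both the splitting behind
projectivity and one of the two inverse identities in `extEquiv`. -/
theorem smul_op_smul_gen (hx : x * x = x) (hy : y * y = y) (p : leftIdeal x) (q : rightIdeal y) :
    (p : A) • MulOpposite.op (q : A) • gen k x y = mk k x y p q := by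
  rw [gen, op_smul_mk, smul_mk]
  congr 1
  · exact Subtype.ext (mul_eq_of_mem_leftIdeal hx p.2)
  · exact Subtype.ext (mul_eq_of_mem_rightIdeal hy q.2)

/-- The inclusion of `A x ⊗ y A` into the enveloping algebra. -/
def toEnv : OuterTensor k x y →ₗ[k] Env k A :=
  TensorProduct.map ((leftIdeal x).subtype.restrictScalars k)
    ((MulOpposite.opLinearEquiv k).toLinearMap ∘ₗ (rightIdeal y).subtype.restrictScalars k)

/-- `A x ⊗ y A` is a projective bimodule if `x` and `y` are idempotent. -/
theorem projective (hx : x * x = x) (hy : y * y = y) :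
    Module.Projective (Env k A) (OuterTensor k x y) := by
  let i : OuterTensor k x y →ₗ[Env k A] Env k A :=
    { toFun := toEnv
      map_add' := map_add _
      map_smul' := fun c z => by
        induction z using induction with
        | h0 => rw [smul_zero, map_zero, smul_zero]
        | hadd z w hz hw => rw [smul_add, map_add, map_add, smul_add, hz, hw]
        | hmk p q =>
          induction c using TensorProduct.induction_on with
          | zero =>
            exact (congrArg toEnv (zero_smul (Env k A) (mk k x y p q))).trans
              ((map_zero toEnv).trans (zero_mul (toEnv (mk k x y p q))).symm)
          | add c d hc hd =>
            exact (congrArg toEnv (add_smul (R := Env k A) c d (mk k x y p q))).trans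
              ((map_add toEnv _ _).trans ((congrArg₂ (· + ·) hc hd).trans
                (add_smul (R := Env k A) c d (toEnv (mk k x y p q))).symm))
          | tmul c d =>
            rw [env_smul_mk]
            exact (Algebra.TensorProduct.tmul_mul_tmul c (p : A) d (MulOpposite.op (q : A))).symm }
  -- The inclusion `i` is split by `1 ↦ x ⊗ y`: the composite sends `p ⊗ q` to `p • (x ⊗ y) • q`,
  -- which is `p ⊗ q`.
  refine Module.Projective.of_split i (LinearMap.toSpanSingleton (Env k A) _ (gen k x y)) ?_
  ext z
  induction z using induction with
  | h0 => rw [map_zero, map_zero]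
  | hadd z w hz hw => rw [map_add, map_add, hz, hw]
  | hmk p q =>
    exact (TensorProduct.Algebra.smul_def (R := k) (p : A) (MulOpposite.op (q : A)) (gen k x y)).trans
      (smul_op_smul_gen hx hy p q)

variable {B : Type*} [Ring B] [Algebra k B]

variable (x y) in
/-- The map `A x ⊗ y A → B`, `p ⊗ q ↦ ν p * b * ν q`. -/
def sandwich (ν : A →ₐ[k] B) (b : B) : OuterTensor k x y →ₗ[k] B :=
  TensorProduct.lift (LinearMap.mk₂ k (fun (p : leftIdeal x) (q : rightIdeal y) => ν p * b * ν q)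
    (fun p p' q => by simp only [Submodule.coe_add, map_add, add_mul])
    (fun c p q => by
      rw [Submodule.coe_smul_of_tower, map_smul, smul_mul_assoc, smul_mul_assoc])
    (fun p q q' => by simp only [Submodule.coe_add, map_add, mul_add])
    (fun c p q => by rw [Submodule.coe_smul_of_tower, map_smul, mul_smul_comm]))

variable (ν : A →ₐ[k] B) (b : B)

theorem sandwich_mk (p : leftIdeal x) (q : rightIdeal y) :
    sandwich x y ν b (mk k x y p q) = ν p * b * ν q := rfl

theorem sandwich_smul (c : A) (z : OuterTensor k x y) :
    sandwich x y ν b (c • z) = ν c * sandwich x y ν b z := by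
  induction z using induction with
  | h0 => rw [smul_zero, map_zero, mul_zero]
  | hadd z w hz hw => rw [smul_add, map_add, map_add, mul_add, hz, hw]
  | hmk p q =>
    rw [smul_mk, sandwich_mk, sandwich_mk]
    simp [mul_assoc]

theorem sandwich_op_smul (c : Aᵐᵒᵖ) (z : OuterTensor k x y) :
    sandwich x y ν b (c • z) = sandwich x y ν b z * ν c.unop := by
  induction z using induction with
  | h0 => rw [smul_zero, map_zero, zero_mul]
  | hadd z w hz hw => rw [smul_add, map_add, map_add, add_mul, hz, hw]
  | hmk p q =>
    rw [op_smul_mk, sandwich_mk, sandwich_mk]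
    simp [mul_assoc]

/-- In the product of two pure tensors the factors meeting in the middle are `q` in `y A` and `p'`
in `A x'`, and `q * p' = y * (q * p') * x'` vanishes by `h`. -/
theorem sandwich_mul_sandwich {x' y' : A} (b' : B) (hy : y * y = y) (hx : x' * x' = x')
    (h : ∀ c, y * c * x' = 0) (z : OuterTensor k x y) (w : OuterTensor k x' y') :
    sandwich x y ν b z * sandwich x' y' ν b' w = 0 := by
  induction z using induction with
  | h0 => rw [map_zero, zero_mul]
  | hadd z z' hz hz' => rw [map_add, add_mul, hz, hz', add_zero]
  | hmk p q =>
    induction w using induction with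
    | h0 => rw [map_zero, mul_zero]
    | hadd w w' hw hw' => rw [map_add, mul_add, hw, hw', add_zero]
    | hmk p' q' =>
      have hqp : (q : A) * p' = 0 := by
        rw [← mul_eq_of_mem_rightIdeal hy q.2, ← mul_eq_of_mem_leftIdeal hx p'.2,
          ← mul_assoc, mul_assoc y, h]
      calc ν p * b * ν q * (ν p' * b' * ν q') = ν p * b * (ν q * ν p') * b' * ν q' := by
            simp only [mul_assoc]
        _ = 0 := by rw [← map_mul, hqp, map_zero, mul_zero, zero_mul, zero_mul]

end OuterTensor

end BimoduleLemmas

/-! ### Sums of two-sided ideals as bimodules -/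

section DirectSumOfIdeals

variable {k : Type w} [Field k] {A : Type u} [Ring A] [Algebra k A] {B : Type v} [Ring B]
  [Algebra k B]

namespace IdealAlong

variable (ν : A →ₐ[k] B) {J J' : TwoSidedIdeal B}

theorem val_add (z w : IdealAlong ν J) : (z + w).val = z.val + w.val := rfl

theorem val_zero : (0 : IdealAlong ν J).val = 0 := rfl

theorem val_mem (z : IdealAlong ν J) : z.val ∈ J := Subtype.property (p := fun b => b ∈ J) z

/-- An element of an ideal as an element of the associated bimodule. -/
def ofMem {b : B} (hb : b ∈ J) : IdealAlong ν J := (⟨b, hb⟩ : J)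

/-- The inclusion of ideals as a homomorphism of bimodules. -/
def inclusion (h : J ≤ J') : IdealAlong ν J →ₗ[Env k A] IdealAlong ν J' :=
  let f : IdealAlong ν J →+ IdealAlong ν J' :=
    { toFun := fun z => ofMem ν (h (val_mem ν z))
      map_zero' := rfl
      map_add' := fun _ _ => rfl }
  { toFun := f
    map_add' := map_add f
    map_smul' := map_env_smul f (fun _ _ => rfl) (fun _ _ => rfl) }

theorem val_inclusion (h : J ≤ J') (z : IdealAlong ν J) : (inclusion ν h z).val = z.val := rfl

end IdealAlong

/-- The sums form a two-sided ideal `K` that contains every `J i`, hence contains their supremum. -/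
theorem exists_sum_of_mem_iSup {ι : Type*} [Fintype ι] {J : ι → TwoSidedIdeal B} {b : B}
    (hb : b ∈ ⨆ i, J i) : ∃ z : ∀ i, J i, ∑ i, (z i : B) = b := by
  classical
  let K : TwoSidedIdeal B := TwoSidedIdeal.mk' {b | ∃ z : ∀ i, J i, ∑ i, (z i : B) = b}
    ⟨fun _ => 0, by simp⟩
    (by
      rintro _ _ ⟨z, rfl⟩ ⟨w, rfl⟩
      exact ⟨fun i => z i + w i, by simp [Finset.sum_add_distrib]⟩)
    (by
      rintro _ ⟨z, rfl⟩
      exact ⟨fun i => -z i, by simp⟩)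
    (by
      rintro c _ ⟨z, rfl⟩
      exact ⟨fun i => ⟨c * z i, (J i).mul_mem_left _ _ (z i).2⟩, by simp [Finset.mul_sum]⟩)
    (by
      rintro _ c ⟨z, rfl⟩
      exact ⟨fun i => ⟨z i * c, (J i).mul_mem_right _ _ (z i).2⟩, by simp [Finset.sum_mul]⟩)
  have hK : ∀ b, b ∈ K ↔ ∃ z : ∀ i, J i, ∑ i, (z i : B) = b := fun b =>
    TwoSidedIdeal.mem_mk' _ _ _ _ _ _ b
  refine (hK b).1 ((iSup_le fun i => ?_ : ⨆ i, J i ≤ K) hb)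
  intro c hc
  refine (hK c).2 ⟨Pi.single i ⟨c, hc⟩, ?_⟩
  rw [Finset.sum_eq_single i]
  · rw [Pi.single_eq_same]
  · intro j _ hj
    rw [Pi.single_eq_of_ne hj]
    rfl
  · simp

/-- The summation map of a finite family of ideals, as a homomorphism of bimodules. -/
def sumIdeals {ι : Type*} [Fintype ι] [DecidableEq ι] (ν : A →ₐ[k] B) (J : ι → TwoSidedIdeal B) :
    (⨁ i, IdealAlong ν (J i)) →ₗ[Env k A] IdealAlong ν (⨆ i, J i) :=
  DirectSum.toModule (Env k A) ι _ fun i => IdealAlong.inclusion ν (le_iSup J i)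

theorem val_sumIdeals {ι : Type*} [Fintype ι] [DecidableEq ι] (ν : A →ₐ[k] B)
    (J : ι → TwoSidedIdeal B) (z : ⨁ i, IdealAlong ν (J i)) :
    (sumIdeals ν J z).val = ∑ i, (z i).val := by
  induction z using DirectSum.induction_on with
  | zero => simp [IdealAlong.val_zero]
  | add z w hz hw =>
    rw [map_add, IdealAlong.val_add, hz, hw, ← Finset.sum_add_distrib]
    rfl
  | of i z =>
    rw [sumIdeals, ← DirectSum.lof_eq_of (Env k A), DirectSum.toModule_lof,
      IdealAlong.val_inclusion, Finset.sum_eq_single i]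
    · rw [DirectSum.lof_eq_of, DirectSum.of_eq_same]
    · intro j _ hj
      rw [DirectSum.lof_eq_of, DirectSum.of_eq_of_ne _ _ _ hj, IdealAlong.val_zero]
    · simp

/-- The summation map of an independent finite family of ideals is an isomorphism. -/
theorem sumIdeals_bijective {ι : Type*} [Fintype ι] [DecidableEq ι] (ν : A →ₐ[k] B)
    (J : ι → TwoSidedIdeal B)
    (hJ : ∀ z : ∀ i, J i, ∑ i, (z i : B) = 0 → ∀ i, (z i : B) = 0) :
    Function.Bijective (sumIdeals ν J) := by
  constructor
  · rw [injective_iff_map_eq_zero]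
    intro z hz
    refine DFinsupp.ext fun i => IdealAlong.val_injective ?_
    refine hJ (fun i => ⟨(z i).val, IdealAlong.val_mem ν _⟩) ?_ i
    rw [← val_sumIdeals, hz, IdealAlong.val_zero]
  · intro b
    obtain ⟨z, hz⟩ := exists_sum_of_mem_iSup (IdealAlong.val_mem ν b)
    refine ⟨(DirectSum.linearEquivFunOnFintype (Env k A) ι fun i => IdealAlong ν (J i)).symm z,
      IdealAlong.val_injective ?_⟩
    rw [val_sumIdeals, ← hz]
    refine Finset.sum_congr rfl fun i _ => ?_
    rfl

end DirectSumOfIdeals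

/-! ### Ideals generated by the `b i` in an algebra identified with a trivial extension -/

section SandwichTrivialExtension

variable {k : Type w} [Field k] {A : Type u} [Ring A] [Algebra k A] {B : Type v} [Ring B]
  [Algebra k B] {t : ℕ} {x y : Fin t → A} {b : Fin t → B} {ν : A →ₐ[k] B}
  (ψ : TrivSqZeroExt A (⨁ i, OuterTensor k (x i) (y i)) ≃ₐ[k] B)
  (hinr : ∀ i z, ψ (.inr (DirectSum.of (fun i => OuterTensor k (x i) (y i)) i z)) =
    OuterTensor.sandwich (x i) (y i) ν (b i) z)
  (hb : ∀ i, ν (x i) * b i * ν (y i) = b i)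

include hinr hb

/-- The sandwich elements for `i` are the image under `ψ` of one summand of the square-zero part.
This image is a two-sided ideal: it contains `b i`, and every element of it is a sum of multiples of
`b i`. -/
theorem mem_span_iff_sandwich (i : Fin t) (c : B) :
    c ∈ TwoSidedIdeal.span {b i} ↔ ∃ z, OuterTensor.sandwich (x i) (y i) ν (b i) z = c := by
  constructor
  · intro hc
    let K : TwoSidedIdeal B := TwoSidedIdeal.mk'
      {c | ∃ z, OuterTensor.sandwich (x i) (y i) ν (b i) z = c}
      ⟨0, map_zero _⟩
      (by
        rintro _ _ ⟨z, rfl⟩ ⟨w, rfl⟩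
        exact ⟨z + w, map_add _ _ _⟩)
      (by
        rintro _ ⟨z, rfl⟩
        exact ⟨-z, map_neg _ _⟩)
      (by
        rintro c _ ⟨z, rfl⟩
        obtain ⟨d, rfl⟩ := ψ.surjective c
        -- The square-zero component of `d` annihilates `inr z`, so only `d.fst` acts.
        refine ⟨d.fst • z, ?_⟩
        rw [← hinr, ← hinr, ← map_mul]
        congr 1
        ext <;> simp [DirectSum.of_smul])
      (by
        rintro _ c ⟨z, rfl⟩
        obtain ⟨d, rfl⟩ := ψ.surjective c
        refine ⟨MulOpposite.op d.fst • z, ?_⟩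
        rw [← hinr, ← hinr, ← map_mul]
        congr 1
        ext <;> simp [DirectSum.of_smul])
    have hK : ∀ c, c ∈ K ↔ ∃ z, OuterTensor.sandwich (x i) (y i) ν (b i) z = c := fun c =>
      TwoSidedIdeal.mem_mk' _ _ _ _ _ _ c
    refine (hK c).1 (TwoSidedIdeal.span_le.2 (Set.singleton_subset_iff.2 ?_) hc)
    exact (hK _).2 ⟨OuterTensor.gen k (x i) (y i), hb i⟩
  · rintro ⟨z, rfl⟩
    induction z using OuterTensor.induction with
    | h0 => rw [map_zero]; exact TwoSidedIdeal.zero_mem _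
    | hadd z w hz hw => rw [map_add]; exact TwoSidedIdeal.add_mem _ hz hw
    | hmk p q =>
      exact TwoSidedIdeal.mul_mem_right _ _ _ (TwoSidedIdeal.mul_mem_left _ _ _
        (TwoSidedIdeal.subset_span rfl))

/-- The sandwich map is `ψ` composed with the inclusion of a summand, hence injective; its image is
the ideal by `mem_span_iff_sandwich`. -/
theorem exists_outerTensor_equiv (i : Fin t) :
    Nonempty (OuterTensor k (x i) (y i) ≃ₗ[Env k A]
      IdealAlong ν (TwoSidedIdeal.span {b i})) := by
  let f : OuterTensor k (x i) (y i) →+ IdealAlong ν (TwoSidedIdeal.span {b i}) :=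
    { toFun := fun z => IdealAlong.ofMem ν ((mem_span_iff_sandwich ψ hinr hb i _).2 ⟨z, rfl⟩)
      map_zero' := IdealAlong.val_injective (map_zero _)
      map_add' := fun z w => IdealAlong.val_injective (map_add _ z w) }
  let g : OuterTensor k (x i) (y i) →ₗ[Env k A] IdealAlong ν (TwoSidedIdeal.span {b i}) :=
    { toFun := f
      map_add' := map_add f
      map_smul' := map_env_smul f
        (fun c z => IdealAlong.val_injective (OuterTensor.sandwich_smul ν (b i) c z))
        (fun c z => IdealAlong.val_injective (OuterTensor.sandwich_op_smul ν (b i) c z)) }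
  refine ⟨LinearEquiv.ofBijective g ⟨fun z w hzw => ?_, fun c => ?_⟩⟩
  · have h : OuterTensor.sandwich (x i) (y i) ν (b i) z =
        OuterTensor.sandwich (x i) (y i) ν (b i) w := congrArg IdealAlong.val hzw
    rw [← hinr, ← hinr] at h
    exact DirectSum.of_injective i (TrivSqZeroExt.inr_injective (ψ.injective h))
  · obtain ⟨z, hz⟩ := (mem_span_iff_sandwich ψ hinr hb i _).1 (IdealAlong.val_mem ν c)
    exact ⟨z, IdealAlong.val_injective hz⟩

/-- A relation between elements of these ideals pulls back along `ψ` to a relation between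
components of a direct sum, so each component is zero. -/
theorem independent_span (z : ∀ i, TwoSidedIdeal.span {b i}) (hz : ∑ i, (z i : B) = 0)
    (i : Fin t) : (z i : B) = 0 := by
  choose w hw using fun i => (mem_span_iff_sandwich ψ hinr hb i (z i)).1 (z i).2
  have h : ψ (.inr (∑ i, DirectSum.of (fun i => OuterTensor k (x i) (y i)) i (w i))) = 0 := by
    rw [← hz, TrivSqZeroExt.inr_sum, map_sum]
    exact Finset.sum_congr rfl fun i _ => (hinr i (w i)).trans (hw i)
  rw [EmbeddingLike.map_eq_zero_iff] at h
  have hi := DFunLike.congr_fun (TrivSqZeroExt.inr_injective h) i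
  rw [DFinsupp.finsetSum_apply, Finset.sum_eq_single i] at hi
  · rw [← hw, ← DirectSum.of_eq_same (β := fun i => OuterTensor k (x i) (y i)) i (w i)]
    exact (congrArg _ hi).trans (map_zero _)
  · intro j _ hj
    exact DirectSum.of_eq_of_ne _ _ _ hj.symm
  · simp

end SandwichTrivialExtension

/-! ### Homomorphisms out of the trivial extension -/

namespace OuterTensor

variable {k : Type w} [Field k] {A : Type u} [Ring A] [Algebra k A] {B : Type v} [Ring B]
  [Algebra k B] {t : ℕ} {x y : Fin t → A} (ν : A →ₐ[k] B) (b : Fin t → B)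

variable (x y) in
/-- The map `⨁ i, A x_i ⊗ y_i A → B` given by `p ⊗ q ↦ ν p * b_i * ν q`. -/
def sandwichSum : (⨁ i, OuterTensor k (x i) (y i)) →ₗ[k] B :=
  DirectSum.toModule k _ _ fun i => sandwich (x i) (y i) ν (b i)

theorem sandwichSum_of (i : Fin t) (z : OuterTensor k (x i) (y i)) :
    sandwichSum x y ν b (DirectSum.of (fun i => OuterTensor k (x i) (y i)) i z) =
      sandwich (x i) (y i) ν (b i) z := by
  rw [sandwichSum, ← DirectSum.lof_eq_of k, DirectSum.toModule_lof]

theorem sandwichSum_smul (c : A) (z : ⨁ i, OuterTensor k (x i) (y i)) :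
    sandwichSum x y ν b (c • z) = ν c * sandwichSum x y ν b z := by
  induction z using DirectSum.induction_on with
  | zero => rw [smul_zero, map_zero, mul_zero]
  | add z z' hz hz' => rw [smul_add, map_add, map_add, mul_add, hz, hz']
  | of i z => rw [← DirectSum.of_smul, sandwichSum_of, sandwichSum_of, sandwich_smul]

theorem sandwichSum_op_smul (c : Aᵐᵒᵖ) (z : ⨁ i, OuterTensor k (x i) (y i)) :
    sandwichSum x y ν b (c • z) = sandwichSum x y ν b z * ν c.unop := by
  induction z using DirectSum.induction_on with
  | zero => rw [smul_zero, map_zero, zero_mul]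
  | add z z' hz hz' => rw [smul_add, map_add, map_add, add_mul, hz, hz']
  | of i z => rw [← DirectSum.of_smul, sandwichSum_of, sandwichSum_of, sandwich_op_smul]

variable (hx : ∀ i, x i * x i = x i) (hy : ∀ i, y i * y i = y i)
  (h : ∀ i j c, y i * c * x j = 0)

include hx hy h in
theorem sandwichSum_mul_sandwichSum (z w : ⨁ i, OuterTensor k (x i) (y i)) :
    sandwichSum x y ν b z * sandwichSum x y ν b w = 0 := by
  induction z using DirectSum.induction_on with
  | zero => rw [map_zero, zero_mul]
  | add z z' hz hz' => rw [map_add, add_mul, hz, hz', add_zero]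
  | of i z =>
    induction w using DirectSum.induction_on with
    | zero => rw [map_zero, mul_zero]
    | add w w' hw hw' => rw [map_add, mul_add, hw, hw', add_zero]
    | of j w =>
      rw [sandwichSum_of, sandwichSum_of]
      exact sandwich_mul_sandwich _ _ _ (hy i) (hx j) (h i j) z w

/-- The homomorphism from the trivial extension given by `ν` and by `sandwichSum`. -/
def extLift : TrivSqZeroExt A (⨁ i, OuterTensor k (x i) (y i)) →ₐ[k] B :=
  TrivSqZeroExt.lift ν (sandwichSum x y ν b) (sandwichSum_mul_sandwichSum ν b hx hy h)
    (sandwichSum_smul ν b) (fun c => sandwichSum_op_smul ν b (MulOpposite.op c))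

theorem extLift_inl (c : A) : extLift ν b hx hy h (.inl c) = ν c := by
  rw [extLift, TrivSqZeroExt.lift_apply_inl]

theorem extLift_inr_of (i : Fin t) (z : OuterTensor k (x i) (y i)) :
    extLift ν b hx hy h (.inr (DirectSum.of (fun i => OuterTensor k (x i) (y i)) i z)) =
      sandwich (x i) (y i) ν (b i) z := by
  rw [extLift, TrivSqZeroExt.lift_apply_inr, sandwichSum_of]

end OuterTensor

/-! ### Removing the arrows: the section of the projection -/

section ArrowRemoval

variable {k : Type w} [Field k] {V : Type u} [Quiver.{v} V] [Fintype V]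
  {I : TwoSidedIdeal (PathAlgebra k V)} {B : Type*} [Ring B] [Algebra k B]

namespace BoundAlgebra

/-- A homomorphism on `kQ` that vanishes on `I` descends to `kQ/I`. -/
def lift (f : PathAlgebra k V →ₐ[k] B) (h : ∀ z ∈ I, f z = 0) : BoundAlgebra I →ₐ[k] B :=
  Ideal.Quotient.liftₐ I.asIdeal f h

theorem lift_boundMk (f : PathAlgebra k V →ₐ[k] B) (h : ∀ z ∈ I, f z = 0) (z : PathAlgebra k V) :
    lift f h (boundMk I z) = f z := rfl

theorem boundMk_surjective : Function.Surjective (boundMk I) := Ideal.Quotient.mk_surjective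

theorem boundMk_eq_zero {z : PathAlgebra k V} (hz : z ∈ I) : boundMk I z = 0 :=
  Ideal.Quotient.eq_zero_iff_mem.2 hz

theorem algHom_ext {f g : BoundAlgebra I →ₐ[k] B}
    (hv : ∀ x, f (vertexClass I x) = g (vertexClass I x))
    (ha : ∀ {x y : V} (b : x ⟶ y), f (arrowClass I b) = g (arrowClass I b)) : f = g := by
  have h : f.comp (boundMk I) = g.comp (boundMk I) := PathAlgebra.algHom_ext hv ha
  refine AlgHom.ext fun z => ?_
  obtain ⟨z, rfl⟩ := boundMk_surjective z
  exact DFunLike.congr_fun h z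

end BoundAlgebra

theorem map_eq_zero_of_mem_span {R : Type*} [Ring R] {C : Type*} [Ring C] (f : R →+* C) {S : Set R}
    (hS : ∀ z ∈ S, f z = 0) {z : R} (hz : z ∈ TwoSidedIdeal.span S) : f z = 0 :=
  (TwoSidedIdeal.mem_ker f).1
    (TwoSidedIdeal.span_le.2 (fun z hz => (TwoSidedIdeal.mem_ker f).2 (hS z hz)) hz)

theorem vertexClass_mul_self (x : V) : vertexClass I x * vertexClass I x = vertexClass I x := by
  rw [vertexClass, ← map_mul, PathAlgebra.vertex_mul_self]

theorem vertexClass_mul_of_ne {x y : V} (h : x ≠ y) : vertexClass I x * vertexClass I y = 0 := by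
  rw [vertexClass, vertexClass, ← map_mul, PathAlgebra.vertex_mul_vertex_of_ne h, map_zero]

theorem sum_vertexClass : ∑ x, vertexClass I x = 1 := by
  simp only [vertexClass]
  rw [← map_sum, ← PathAlgebra.one_eq, map_one]

theorem vertexClass_mul_arrowClass {x y : V} (b : x ⟶ y) :
    vertexClass I x * arrowClass I b = arrowClass I b := by
  rw [vertexClass, arrowClass, ← map_mul, PathAlgebra.vertex_mul_arrow]

theorem arrowClass_mul_vertexClass {x y : V} (b : x ⟶ y) :
    arrowClass I b * vertexClass I y = arrowClass I b := by
  rw [vertexClass, arrowClass, ← map_mul, PathAlgebra.arrow_mul_vertex]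

variable {t : ℕ} {s e : Fin t → V} {a : ∀ i, s i ⟶ e i}

namespace Removal

/-- A homomorphism on `Λ` that vanishes on the classes of the removed arrows descends to `Γ`. -/
def lift (f : BoundAlgebra I →ₐ[k] B) (h : ∀ i, f (arrowClass I (a i)) = 0) :
    Removal I a →ₐ[k] B :=
  Ideal.Quotient.liftₐ (removedIdeal I a).asIdeal f fun _ hz =>
    map_eq_zero_of_mem_span f.toRingHom (Set.forall_mem_range.2 h) hz

theorem proj_surjective : Function.Surjective (proj I a) := Ideal.Quotient.mk_surjective

theorem proj_arrowClass (i : Fin t) : proj I a (arrowClass I (a i)) = 0 :=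
  Ideal.Quotient.eq_zero_iff_mem.2 (TwoSidedIdeal.subset_span ⟨i, rfl⟩)

theorem algHom_ext {f g : Removal I a →ₐ[k] B}
    (hv : ∀ x, f (removalVertex I a x) = g (removalVertex I a x))
    (ha : ∀ {x y : V} (b : x ⟶ y), f (proj I a (arrowClass I b)) = g (proj I a (arrowClass I b))) :
    f = g := by
  have h : f.comp (proj I a) = g.comp (proj I a) := BoundAlgebra.algHom_ext hv ha
  refine AlgHom.ext fun z => ?_
  obtain ⟨z, rfl⟩ := proj_surjective z
  exact DFunLike.congr_fun h z

end Removal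

theorem removalVertex_mul_self (x : V) :
    removalVertex I a x * removalVertex I a x = removalVertex I a x := by
  rw [removalVertex, ← map_mul, vertexClass_mul_self]

/-- An arrow is one of the arrows `a i`. -/
def IsRemoved (a : ∀ i, s i ⟶ e i) {x y : V} (b : x ⟶ y) : Prop :=
  ∃ i, (⟨x, y, b⟩ : Σ x y : V, x ⟶ y) = ⟨s i, e i, a i⟩

/-- Two homomorphisms on `kQ` that agree on vertices and on the arrows that are not removed agree
on the elements in which no removed arrow occurs. -/
theorem map_congr_of_not_occurs {f g : PathAlgebra k V →ₐ[k] B}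
    (hv : ∀ x, f (PathAlgebra.vertex k x) = g (PathAlgebra.vertex k x))
    (ha : ∀ {x y : V} (b : x ⟶ y), ¬ IsRemoved a b →
      f (PathAlgebra.arrow k b) = g (PathAlgebra.arrow k b))
    {z : PathAlgebra k V} (hz : ∀ i, ¬ Occurs (a i) z) : f z = g z := by
  refine PathAlgebra.map_congr_of_occurs hv z fun {x y} b hb => ha b ?_
  rintro ⟨i, hi⟩
  cases hi
  exact hz i hb

variable (I a) in
open Classical in
/-- The homomorphism `kQ → Λ` that fixes the vertices and the arrows that are not removed, and sends
the removed arrows to zero. -/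
def killArrows : PathAlgebra k V →ₐ[k] BoundAlgebra I :=
  PathAlgebra.lift (vertexClass I) (fun b => if IsRemoved a b then 0 else arrowClass I b)
    vertexClass_mul_self (fun _ _ => vertexClass_mul_of_ne) sum_vertexClass
    (fun b => by rw [ite_mul, zero_mul, arrowClass_mul_vertexClass])

theorem killArrows_vertex (x : V) :
    killArrows I a (PathAlgebra.vertex k x) = vertexClass I x := by
  rw [killArrows, PathAlgebra.lift_vertex]
  intro x y b
  rw [ite_mul, zero_mul, arrowClass_mul_vertexClass]

open Classical in
theorem killArrows_arrow {x y : V} (b : x ⟶ y) :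
    killArrows I a (PathAlgebra.arrow k b) = if IsRemoved a b then 0 else arrowClass I b := by
  rw [killArrows, PathAlgebra.lift_arrow]
  · intro x y b
    rw [ite_mul, zero_mul, arrowClass_mul_vertexClass]
  · intro x y b
    rw [mul_ite, mul_zero, vertexClass_mul_arrowClass]

/-- The ideal `I` is generated by elements in which no removed arrow occurs. -/
def GeneratedAvoiding (I : TwoSidedIdeal (PathAlgebra k V)) (a : ∀ i, s i ⟶ e i) : Prop :=
  ∃ S : Set (PathAlgebra k V), TwoSidedIdeal.span S = I ∧ ∀ g ∈ S, ∀ i, ¬ Occurs (a i) g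

/-- On each generator `f` agrees with `g` after the projection to `Λ`, which kills it; the values of
`f` at the removed arrows play no role. With `g` the identity this produces `ν`, and with `g` the
map `Λ → Γ → Γ ⋉ P` it produces `toExt`. -/
theorem map_eq_zero_of_generatedAvoiding (hI : GeneratedAvoiding I a)
    {f : PathAlgebra k V →ₐ[k] B} (g : BoundAlgebra I →ₐ[k] B)
    (hv : ∀ x, f (PathAlgebra.vertex k x) = g (vertexClass I x))
    (ha : ∀ {x y : V} (b : x ⟶ y), ¬ IsRemoved a b →
      f (PathAlgebra.arrow k b) = g (arrowClass I b)) (z : PathAlgebra k V) (hz : z ∈ I) :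
    f z = 0 := by
  obtain ⟨S, hS, hocc⟩ := hI
  rw [← hS] at hz
  refine map_eq_zero_of_mem_span f.toRingHom (fun z hz => ?_) hz
  have h : f z = (g.comp (boundMk I)) z := map_congr_of_not_occurs hv ha (hocc z hz)
  refine h.trans ((congrArg g (BoundAlgebra.boundMk_eq_zero ?_)).trans (map_zero g))
  rw [← hS]
  exact TwoSidedIdeal.subset_span hz

/-- The section `ν : Γ → Λ` of the projection. -/
def removalSection (hI : GeneratedAvoiding I a) : Removal I a →ₐ[k] BoundAlgebra I :=
  Removal.lift (BoundAlgebra.lift (killArrows I a)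
    (map_eq_zero_of_generatedAvoiding hI (AlgHom.id k _) killArrows_vertex
      fun b hb => (killArrows_arrow b).trans (if_neg hb)))
    fun i => (BoundAlgebra.lift_boundMk _ _ _).trans
      ((killArrows_arrow (a i)).trans (if_pos ⟨i, rfl⟩))

theorem removalSection_vertex (hI : GeneratedAvoiding I a) (x : V) :
    removalSection hI (removalVertex I a x) = vertexClass I x :=
  killArrows_vertex x

theorem removalSection_arrow (hI : GeneratedAvoiding I a) {x y : V} (b : x ⟶ y)
    (hb : ¬ IsRemoved a b) : removalSection hI (proj I a (arrowClass I b)) = arrowClass I b :=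
  (killArrows_arrow b).trans (if_neg hb)

theorem proj_arrowClass_of_isRemoved {x y : V} {b : x ⟶ y} (hb : IsRemoved a b) :
    proj I a (arrowClass I b) = 0 := by
  obtain ⟨i, hi⟩ := hb
  cases hi
  exact Removal.proj_arrowClass i

theorem proj_removalSection (hI : GeneratedAvoiding I a) (c : Removal I a) :
    proj I a (removalSection hI c) = c := by
  have h : (proj I a).comp (removalSection hI) = AlgHom.id k _ := by
    refine Removal.algHom_ext (fun x => ?_) fun b => ?_
    · exact congrArg (proj I a) (removalSection_vertex hI x)
    · by_cases hb : IsRemoved a b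
      · rw [proj_arrowClass_of_isRemoved hb, map_zero, map_zero]
      · exact congrArg (proj I a) (removalSection_arrow hI b hb)
  exact DFunLike.congr_fun h c

/-! ### The isomorphism between the bound algebra and the trivial extension -/

variable (I a) in
/-- The bimodule `P = ⨁ Γ e_i ⊗ f_i Γ`. -/
abbrev RemovalBimodule :=
  ⨁ i, OuterTensor k (removalVertex I a (s i)) (removalVertex I a (e i))

variable (I a) in
/-- The inclusion of a summand of `P`. -/
abbrev ofSummand (i : Fin t) :
    OuterTensor k (removalVertex I a (s i)) (removalVertex I a (e i)) →+ RemovalBimodule I a :=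
  DirectSum.of (fun i => OuterTensor k (removalVertex I a (s i)) (removalVertex I a (e i))) i

variable (I a) in
open Classical in
/-- The element of `P` assigned to an arrow: `e_i ⊗ f_i` for `a_i`, and zero for other arrows. -/
def arrowGen {x y : V} (b : x ⟶ y) : RemovalBimodule I a :=
  ∑ i, if (⟨x, y, b⟩ : Σ x y : V, x ⟶ y) = ⟨s i, e i, a i⟩ then
    ofSummand I a i (OuterTensor.gen k _ _) else 0

theorem arrowGen_eq_zero {x y : V} {b : x ⟶ y} (hb : ¬ IsRemoved a b) : arrowGen I a b = 0 :=
  Finset.sum_eq_zero fun i _ => if_neg fun h => hb ⟨i, h⟩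

/-- Distinctness of the removed arrows leaves exactly one non-zero term in the sum. Arrows are
compared together with their endpoints because the endpoints vary with `i`. -/
theorem arrowGen_self (ha : Function.Injective fun i => (⟨s i, e i, a i⟩ : Σ x y : V, x ⟶ y))
    (i : Fin t) : arrowGen I a (a i) = ofSummand I a i (OuterTensor.gen k _ _) := by
  rw [arrowGen, Finset.sum_eq_single i]
  · exact if_pos rfl
  · exact fun j _ hj => if_neg fun h => hj (ha h).symm
  · simp

theorem smul_arrowGen {x y : V} (b : x ⟶ y) :
    removalVertex I a x • arrowGen I a b = arrowGen I a b := by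
  rw [arrowGen, Finset.smul_sum]
  refine Finset.sum_congr rfl fun i _ => ?_
  split_ifs with h
  · cases h
    rw [← DirectSum.of_smul, OuterTensor.gen, OuterTensor.smul_mk]
    congr 2
    exact Subtype.ext (removalVertex_mul_self _)
  · exact smul_zero _

theorem op_smul_arrowGen {x y : V} (b : x ⟶ y) :
    MulOpposite.op (removalVertex I a y) • arrowGen I a b = arrowGen I a b := by
  rw [arrowGen, Finset.smul_sum]
  refine Finset.sum_congr rfl fun i _ => ?_
  split_ifs with h
  · cases h
    rw [← DirectSum.of_smul, OuterTensor.gen, OuterTensor.op_smul_mk]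
    congr 2
    exact Subtype.ext (removalVertex_mul_self _)
  · exact smul_zero _

theorem extArrow_mul_vertex {x y : V} (b : x ⟶ y) :
    (.inl (proj I a (arrowClass I b)) + .inr (arrowGen I a b) :
      TrivSqZeroExt (Removal I a) (RemovalBimodule I a)) * .inl (removalVertex I a y) =
      .inl (proj I a (arrowClass I b)) + .inr (arrowGen I a b) := by
  rw [add_mul, ← TrivSqZeroExt.inl_mul, TrivSqZeroExt.inr_mul_inl, op_smul_arrowGen,
    removalVertex, ← map_mul, arrowClass_mul_vertexClass]

theorem vertex_mul_extArrow {x y : V} (b : x ⟶ y) :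
    .inl (removalVertex I a x) * (.inl (proj I a (arrowClass I b)) + .inr (arrowGen I a b) :
      TrivSqZeroExt (Removal I a) (RemovalBimodule I a)) =
      .inl (proj I a (arrowClass I b)) + .inr (arrowGen I a b) := by
  rw [mul_add, ← TrivSqZeroExt.inl_mul, TrivSqZeroExt.inl_mul_inr, smul_arrowGen,
    removalVertex, ← map_mul, vertexClass_mul_arrowClass]

variable (I a) in
/-- The homomorphism `kQ → Γ ⋉ P` that sends the removed arrows to the generators of `P`. -/
def pathToExt : PathAlgebra k V →ₐ[k] TrivSqZeroExt (Removal I a) (RemovalBimodule I a) :=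
  PathAlgebra.lift (fun x => .inl (removalVertex I a x))
    (fun b => .inl (proj I a (arrowClass I b)) + .inr (arrowGen I a b))
    (fun x => by rw [← TrivSqZeroExt.inl_mul, removalVertex_mul_self])
    (fun x y h => by
      rw [← TrivSqZeroExt.inl_mul, removalVertex, removalVertex, ← map_mul,
        vertexClass_mul_of_ne h, map_zero, TrivSqZeroExt.inl_zero])
    (by
      simp only [removalVertex]
      rw [← TrivSqZeroExt.inl_sum, ← map_sum, sum_vertexClass, map_one, TrivSqZeroExt.inl_one])
    extArrow_mul_vertex

theorem pathToExt_vertex (x : V) :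
    pathToExt I a (PathAlgebra.vertex k x) = .inl (removalVertex I a x) := by
  rw [pathToExt, PathAlgebra.lift_vertex]

theorem pathToExt_arrow {x y : V} (b : x ⟶ y) :
    pathToExt I a (PathAlgebra.arrow k b) =
      .inl (proj I a (arrowClass I b)) + .inr (arrowGen I a b) := by
  rw [pathToExt, PathAlgebra.lift_arrow]
  exact vertex_mul_extArrow

/-- The homomorphism `Λ → Γ ⋉ P`. -/
def toExt (hI : GeneratedAvoiding I a) :
    BoundAlgebra I →ₐ[k] TrivSqZeroExt (Removal I a) (RemovalBimodule I a) :=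
  BoundAlgebra.lift (pathToExt I a)
    (map_eq_zero_of_generatedAvoiding hI ((TrivSqZeroExt.inlAlgHom k _ _).comp (proj I a))
      pathToExt_vertex fun b hb => (pathToExt_arrow b).trans (by
        rw [arrowGen_eq_zero hb, TrivSqZeroExt.inr_zero, add_zero]
        rfl))

theorem toExt_vertex (hI : GeneratedAvoiding I a) (x : V) :
    toExt hI (vertexClass I x) = .inl (removalVertex I a x) := pathToExt_vertex x

theorem toExt_arrow (hI : GeneratedAvoiding I a) {x y : V} (b : x ⟶ y) :
    toExt hI (arrowClass I b) = .inl (proj I a (arrowClass I b)) + .inr (arrowGen I a b) :=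
  pathToExt_arrow b

/-- It suffices to compare on generators of `Γ`: removed arrows are zero there, and any other arrow
has no component in `P`. -/
theorem toExt_removalSection (hI : GeneratedAvoiding I a) (c : Removal I a) :
    toExt hI (removalSection hI c) = .inl c := by
  have h : (toExt hI).comp (removalSection hI) = TrivSqZeroExt.inlAlgHom k _ _ := by
    refine Removal.algHom_ext (fun x => ?_) fun b => ?_
    · exact (congrArg (toExt hI) (removalSection_vertex hI x)).trans (toExt_vertex hI x)
    · by_cases hb : IsRemoved a b
      · rw [proj_arrowClass_of_isRemoved hb, map_zero, map_zero]
      · refine (congrArg (toExt hI) (removalSection_arrow hI b hb)).trans ?_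
        rw [toExt_arrow, arrowGen_eq_zero hb, TrivSqZeroExt.inr_zero, add_zero]
        rfl
  exact DFunLike.congr_fun h c

theorem sandwich_gen (hI : GeneratedAvoiding I a) (i : Fin t) :
    OuterTensor.sandwich _ _ (removalSection hI) (arrowClass I (a i))
      (OuterTensor.gen k (removalVertex I a (s i)) (removalVertex I a (e i))) =
      arrowClass I (a i) := by
  rw [OuterTensor.gen, OuterTensor.sandwich_mk, removalSection_vertex, removalSection_vertex,
    vertexClass_mul_arrowClass, arrowClass_mul_vertexClass]

/-- The homomorphism `Γ ⋉ P → Λ`. -/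
def ofExt (hI : GeneratedAvoiding I a)
    (hz : ∀ i j c, removalVertex I a (e i) * c * removalVertex I a (s j) = 0) :
    TrivSqZeroExt (Removal I a) (RemovalBimodule I a) →ₐ[k] BoundAlgebra I :=
  OuterTensor.extLift (removalSection hI) (fun i => arrowClass I (a i))
    (fun _ => removalVertex_mul_self _) (fun _ => removalVertex_mul_self _) hz

section

variable (hI : GeneratedAvoiding I a)
  (hz : ∀ i j c, removalVertex I a (e i) * c * removalVertex I a (s j) = 0)

theorem ofExt_inl (c : Removal I a) : ofExt hI hz (.inl c) = removalSection hI c :=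
  OuterTensor.extLift_inl _ _ _ _ _ c

theorem ofExt_inr (i : Fin t)
    (z : OuterTensor k (removalVertex I a (s i)) (removalVertex I a (e i))) :
    ofExt hI hz (.inr (ofSummand I a i z)) =
      OuterTensor.sandwich _ _ (removalSection hI) (arrowClass I (a i)) z := by
  have h := OuterTensor.extLift_inr_of (x := fun i => removalVertex I a (s i))
    (y := fun i => removalVertex I a (e i)) (removalSection hI) (fun i => arrowClass I (a i))
    (fun _ => removalVertex_mul_self _) (fun _ => removalVertex_mul_self _) hz i z
  unfold ofExt
  exact h

end

/-- `Λ` is the trivial extension of `Γ` by `P`. -/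
def extEquiv (ha : Function.Injective fun i => (⟨s i, e i, a i⟩ : Σ x y : V, x ⟶ y))
    (hI : GeneratedAvoiding I a)
    (hz : ∀ i j c, removalVertex I a (e i) * c * removalVertex I a (s j) = 0) :
    TrivSqZeroExt (Removal I a) (RemovalBimodule I a) ≃ₐ[k] BoundAlgebra I :=
  AlgEquiv.ofAlgHom (ofExt hI hz) (toExt hI)
    (by
      refine BoundAlgebra.algHom_ext (fun x => ?_) fun {x y} b => ?_
      · refine (congrArg (ofExt hI hz) (toExt_vertex hI x)).trans ?_
        exact (ofExt_inl hI hz _).trans (removalSection_vertex hI x)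
      · refine (congrArg (ofExt hI hz) (toExt_arrow hI b)).trans ?_
        rw [map_add]
        rw [ofExt_inl]
        -- A removed arrow goes to `e_i ⊗ f_i`, which the sandwich map returns to its class; any
        -- other arrow goes into `Γ` and is returned by `ν`.
        by_cases hb : IsRemoved a b
        · obtain ⟨i, hi⟩ := hb
          cases hi
          rw [Removal.proj_arrowClass, map_zero, zero_add, arrowGen_self ha, ofExt_inr,
            sandwich_gen]
          rfl
        · rw [arrowGen_eq_zero hb, TrivSqZeroExt.inr_zero, map_zero, add_zero, removalSection_arrow hI b hb]
          rfl)
    (by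
      refine TrivSqZeroExt.algHom_ext' (AlgHom.ext fun c => ?_) (DirectSum.linearMap_ext k fun i =>
        LinearMap.ext fun z => ?_)
      · exact (congrArg (toExt hI) (ofExt_inl hI hz c)).trans
          (toExt_removalSection hI c)
      · refine (congrArg (toExt hI) (ofExt_inr hI hz i z)).trans ?_
        change _ = TrivSqZeroExt.inr (ofSummand I a i z)
        induction z using OuterTensor.induction with
        | h0 => simp only [map_zero, TrivSqZeroExt.inr_zero]
        | hadd z w hz hw => simp only [map_add, TrivSqZeroExt.inr_add, hz, hw]
        | hmk p q =>
          -- The element `ν p * ā_i * ν q` goes to `p • (e_i ⊗ f_i) • q`, which is `p ⊗ q` because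
          -- $p\in\Gamma e_i$ and $q\in f_i\Gamma$.
          rw [OuterTensor.sandwich_mk, map_mul, map_mul, toExt_removalSection,
            toExt_removalSection, toExt_arrow, Removal.proj_arrowClass, TrivSqZeroExt.inl_zero,
            zero_add, arrowGen_self ha, TrivSqZeroExt.inl_mul_inr, TrivSqZeroExt.inr_mul_inl,
            ← DirectSum.of_smul, ← DirectSum.of_smul, ← smul_comm (p : Removal I a),
            OuterTensor.smul_op_smul_gen (removalVertex_mul_self _) (removalVertex_mul_self _)])

theorem extEquiv_inr (ha : Function.Injective fun i => (⟨s i, e i, a i⟩ : Σ x y : V, x ⟶ y))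
    (hI : GeneratedAvoiding I a)
    (hz : ∀ i j c, removalVertex I a (e i) * c * removalVertex I a (s j) = 0) (i : Fin t)
    (z : OuterTensor k (removalVertex I a (s i)) (removalVertex I a (e i))) :
    extEquiv ha hI hz (.inr (ofSummand I a i z)) =
      OuterTensor.sandwich _ _ (removalSection hI) (arrowClass I (a i)) z :=
  ofExt_inr hI hz i z

end ArrowRemoval

end

end QuiverAlg

/-! ### Assembling the theorem -/

open QuiverAlg in
theorem mainTheorem8 {k : Type*} [Field k] {V : Type*} [Quiver V] [Fintype V]
    [∀ x y : V, Finite (x ⟶ y)]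
    (I : TwoSidedIdeal (PathAlgebra k V)) (hI : IsAdmissible I)
    (t : ℕ) (s e : Fin t → V) (a : ∀ i, s i ⟶ e i)
    (ha : Function.Injective fun i => (⟨s i, e i, a i⟩ : Σ x y : V, x ⟶ y))
    (hgen : ∃ S : Set (PathAlgebra k V), IsMinimalGeneratingSet I S ∧
      ∀ g ∈ S, ∀ i, ¬ Occurs (a i) g)
    (hHom : ∀ i j, ∀ φ : HomRight (vertexClass I (s i)) (vertexClass I (e j)), φ = 0) :
    (∀ i j,
      Nonempty (corner k (removalVertex I a (e j)) (removalVertex I a (s i)) ≃ₗ[k]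
        HomRight (removalVertex I a (s i)) (removalVertex I a (e j))) ∧
      corner k (removalVertex I a (e j)) (removalVertex I a (s i)) = ⊥ ∧
      ∀ φ : HomRight (removalVertex I a (s i)) (removalVertex I a (e j)), φ = 0) ∧
    (∃ ν : Removal I a →ₐ[k] BoundAlgebra I,
      (∀ c, proj I a (ν c) = c) ∧
      (∀ x : V, ν (removalVertex I a x) = vertexClass I x) ∧
      (∀ (x y : V) (b : x ⟶ y), (∀ i, (⟨x, y, b⟩ : Σ x y : V, x ⟶ y) ≠ ⟨s i, e i, a i⟩) →
        ν (proj I a (arrowClass I b)) = arrowClass I b) ∧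
      (∃ Ψ : (⨁ i, IdealAlong ν (TwoSidedIdeal.span {arrowClass I (a i)}))
            ≃ₗ[Env k (Removal I a)]
          IdealAlong ν (⨆ i, TwoSidedIdeal.span {arrowClass I (a i)}),
        ∀ z, (Ψ z).val = ∑ i, (z i).val) ∧
      (∀ i, Nonempty (IdealAlong ν (TwoSidedIdeal.span {arrowClass I (a i)})
        ≃ₗ[Env k (Removal I a)] OuterTensor k (removalVertex I a (s i)) (removalVertex I a (e i)))) ∧
      Module.Projective (Env k (Removal I a))
        (IdealAlong ν (⨆ i, TwoSidedIdeal.span {arrowClass I (a i)}))) ∧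
    Nonempty (BoundAlgebra I ≃ₐ[k] TrivSqZeroExt (Removal I a)
      (⨁ i, OuterTensor k (removalVertex I a (s i)) (removalVertex I a (e i)))) := by
  have hI' : GeneratedAvoiding I a := by
    obtain ⟨S, hS, hocc⟩ := hgen
    exact ⟨S, hS.1, hocc⟩
  have hz : ∀ i j c, removalVertex I a (e i) * c * removalVertex I a (s j) = 0 := fun i j c => by
    obtain ⟨c, rfl⟩ := Removal.proj_surjective c
    -- Lifting `c` to `Λ` puts the product in the image of $f_i\Lambda
    -- e_j\cong\operatorname{Hom}_\Lambda(e_j\Lambda,f_i\Lambda)=0$; hence the indices are swapped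
    -- in `hHom j i`.
    rw [removalVertex, removalVertex, ← map_mul, ← map_mul,
      mul_mul_eq_zero_of_homRight k (vertexClass_mul_self _) (hHom j i), map_zero]
  have hinr := extEquiv_inr ha hI' hz
  have hb : ∀ i, removalSection hI' (removalVertex I a (s i)) * arrowClass I (a i) *
      removalSection hI' (removalVertex I a (e i)) = arrowClass I (a i) := fun i => by
    rw [removalSection_vertex, removalSection_vertex, vertexClass_mul_arrowClass,
      arrowClass_mul_vertexClass]
  let Ψ := LinearEquiv.ofBijective
    (sumIdeals (removalSection hI') fun i => TwoSidedIdeal.span {arrowClass I (a i)})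
    (sumIdeals_bijective _ _ (independent_span (extEquiv ha hI' hz) hinr hb))
  have hiso := exists_outerTensor_equiv (extEquiv ha hI' hz) hinr hb
  refine ⟨fun i j => ⟨⟨cornerEquivHomRight k (removalVertex_mul_self _)⟩, corner_eq_bot (hz j i),
    homRight_eq_zero k (removalVertex_mul_self _) (hz j i)⟩,
    ⟨removalSection hI', proj_removalSection hI', removalSection_vertex hI',
      fun x y b hb => removalSection_arrow hI' b fun ⟨i, hi⟩ => hb i hi,
      ⟨Ψ, val_sumIdeals _ _⟩, fun i => (hiso i).map LinearEquiv.symm, ?_⟩,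
    ⟨(extEquiv ha hI' hz).symm⟩⟩
  -- Projectivity passes from each $\Gamma e_i\otimes f_i\Gamma$ to the corresponding ideal, then to
  -- the direct sum of the ideals, and along `Ψ` to their sum.
  have hproj : ∀ i, Module.Projective (Env k (Removal I a))
      (IdealAlong (removalSection hI') (TwoSidedIdeal.span {arrowClass I (a i)})) := fun i =>
    have := OuterTensor.projective (k := k) (removalVertex_mul_self (I := I) (a := a) (s i))
      (removalVertex_mul_self (I := I) (a := a) (e i))
    Module.Projective.of_equiv (hiso i).some
  exact Module.Projective.of_equiv Ψ
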